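/- Let $D=2^{<\omega}$ be the set of all finite binary sequences and let $cD=D\cup 2^\omega$, topologized so that every point of $D$ is isolated and every $x\in 2^\omega$ has the sets $$U(x,n)=\{s\in cD : x\restriction n\subseteq s\}\qquad(n\in\omega)$$ as a neighbourhood base. Let $\mathbb{C}=2^\omega\cup\{\infty\}$ with $\infty\notin 2^\omega$, topologized so that every point of $2^\omega$ is isolated and the sets $U\ni\infty$ for which $\mathbb{C}\setminus U$ is countable form a local base at $\infty$. Let $$X=(\mathbb{C}\times D)\cup\{(x,x):x\in 2^\omega\}$$ with the subspace topology from the product $\mathbb{C}\times cD$, and let $R=\{\infty\}\times D\subseteq X$. Then $X$ is realcompact (that is, homeomorphic to a closed subspace of a power $\mathbb{R}^\kappa$ of the real line), $R$ is a closed subset of $X$ that is homeomorphic to the discrete space $\mathbb{N}$, and $R$ is not $C^*$-embedded in $X$: some bounded continuous function $R\to\mathbb{R}$ has no bounded continuous extension $X\to\mathbb{R}$. -/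

import Mathlib

open Topology
open scoped BoundedContinuousFunction

universe u

/-- A space is realcompact if it can be embedded into a power of the real line
as a closed subset. -/
def IsRealcompact (X : Type u) [TopologicalSpace X] : Prop :=
  ∃ (ι : Type u) (f : X → (ι → ℝ)), IsClosedEmbedding f

/-- `A` is `C*`-embedded in `X`: every bounded continuous real-valued function on the
subspace `A` has a bounded continuous extension to `X`. -/
def IsCStarEmbedded {X : Type u} [TopologicalSpace X] (A : Set X) : Prop :=
  ∀ f : A →ᵇ ℝ, ∃ g : X →ᵇ ℝ, ∀ a : A, g a = f a

/-- `A` is a closed copy of `ℕ` in `X`: it is closed and, with the subspace topology,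
homeomorphic to the discrete space of natural numbers. -/
def IsClosedCopyOfNat {X : Type u} [TopologicalSpace X] (A : Set X) : Prop :=
  IsClosed A ∧ Nonempty (A ≃ₜ ℕ)

/-- The underlying set of `cD`: the nodes of the tree `D` of finite binary sequences
together with its branches, the infinite binary sequences. -/
inductive TreeCompactification : Type
  | node (s : List Bool)
  | branch (x : ℕ → Bool)

namespace TreeCompactification

/-- The `i`-th term of a finite or infinite sequence, if there is one. -/
def term : TreeCompactification → ℕ → Option Bool
  | node s, i => s[i]?
  | branch x, i => some (x i)

/-- The wedge of all finite and infinite sequences that extend the restriction of `x` to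
its first `n` terms. -/
def wedge (x : ℕ → Bool) (n : ℕ) : Set TreeCompactification :=
  {t | ∀ i < n, t.term i = some (x i)}

/-- Nodes are isolated, and the wedges at a branch form its neighbourhood base. -/
instance : TopologicalSpace TreeCompactification where
  IsOpen V := ∀ x, branch x ∈ V → ∃ n, wedge x n ⊆ V
  isOpen_univ := fun _ _ => ⟨0, Set.subset_univ _⟩
  isOpen_inter := by
    intro V W hV hW x hx
    obtain ⟨m, hm⟩ := hV x hx.1
    obtain ⟨n, hn⟩ := hW x hx.2
    exact ⟨max m n, fun t ht =>
      ⟨hm fun i hi => ht i (lt_of_lt_of_le hi (le_max_left m n)),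
        hn fun i hi => ht i (lt_of_lt_of_le hi (le_max_right m n))⟩⟩
  isOpen_sUnion := by
    intro S hS x hx
    obtain ⟨V, hV, hxV⟩ := hx
    obtain ⟨n, hn⟩ := hS V hV x hxV
    exact ⟨n, hn.trans (Set.subset_sUnion_of_mem hV)⟩

end TreeCompactification

/-- The underlying set of `ℂ`: the infinite binary sequences and one further point `∞`. -/
inductive LindelofCantor : Type
  | point (x : ℕ → Bool)
  | infty

namespace LindelofCantor

/-- Every infinite binary sequence is isolated, and the neighbourhoods of `∞` are the sets
that contain `∞` and have a countable complement. -/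
instance : TopologicalSpace LindelofCantor where
  IsOpen V := infty ∈ V → Vᶜ.Countable
  isOpen_univ := by simp
  isOpen_inter := by
    intro V W hV hW h
    rw [Set.compl_inter]
    exact (hV h.1).union (hW h.2)
  isOpen_sUnion := by
    intro S hS h
    obtain ⟨V, hV, hi⟩ := h
    exact (hS V hV hi).mono (Set.compl_subset_compl.mpr (Set.subset_sUnion_of_mem hV))

end LindelofCantor

/-- The subset `(ℂ × D) ∪ {(x, x) : x ∈ 2^ω}` of the product `ℂ × cD`. As a type it carries
the subspace topology. -/
def diagonalPlank : Set (LindelofCantor × TreeCompactification) :=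
  {p | ∃ c s, p = (c, TreeCompactification.node s)} ∪
    {p | ∃ x, p = (LindelofCantor.point x, TreeCompactification.branch x)}

/-- The right-hand side `{∞} × D`, as a subset of the plank. -/
def rightHandSide : Set diagonalPlank :=
  {p | ∃ s, (p : LindelofCantor × TreeCompactification) =
    (LindelofCantor.infty, TreeCompactification.node s)}

/-! Realcompactness reduces to two facts: continuous real functions separate points, and an
ultrafilter along which they all converge is convergent (`plank_exists_le_nhds`). Both coordinates
of such an ultrafilter converge, since cD is compact and ℂ has enough functions. A limit outside the
plank would be (c, y) with y a branch and c ≠ y; there the first difference from y yields a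
continuous function tending to infinity. Extension fails because a continuous g equals its values at
∞ on each row off a countable set. There are countably many rows and uncountably many x, so some x
works for all rows, and continuity at (x, x) makes g(∞, x↾n) converge. The parity of the length does
not converge along any branch. -/

open Filter

/-! ### Compactness of cD and the first difference from a branch -/

namespace TreeCompactification

theorem isOpen_iff {V : Set TreeCompactification} :
    IsOpen V ↔ ∀ x, branch x ∈ V → ∃ n, wedge x n ⊆ V := Iff.rfl

theorem isOpen_singleton_node (s : List Bool) : IsOpen {node s} :=
  isOpen_iff.2 fun _ h => by simp at h

theorem branch_mem_wedge (x : ℕ → Bool) (n : ℕ) : branch x ∈ wedge x n := fun _ _ => rfl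

theorem isOpen_wedge (x : ℕ → Bool) (n : ℕ) : IsOpen (wedge x n) :=
  isOpen_iff.2 fun _ hy => ⟨n, fun _ ht i hi => (ht i hi).trans (hy i hi)⟩

theorem wedge_mem_nhds (x : ℕ → Bool) (n : ℕ) : wedge x n ∈ 𝓝 (branch x) :=
  (isOpen_wedge x n).mem_nhds (branch_mem_wedge x n)

theorem ext_term {t u : TreeCompactification} (h : ∀ i, t.term i = u.term i) : t = u := by
  cases t with
  | node s =>
    cases u with
    | node s' => exact congrArg node (List.ext_getElem? h)
    | branch y => simpa [term] using h s.length
  | branch x =>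
    cases u with
    | node s' => simpa [term] using h s'.length
    | branch y => exact congrArg branch (funext fun i => by simpa [term] using h i)

theorem isLocallyConstant_term (i : ℕ) : IsLocallyConstant fun t => term t i := by
  refine (IsLocallyConstant.iff_eventually_eq _).2 fun t => ?_
  cases t with
  | node s =>
    filter_upwards [(isOpen_singleton_node s).mem_nhds rfl] with u hu
    rw [Set.mem_singleton_iff.1 hu]
  | branch x =>
    filter_upwards [wedge_mem_nhds x (i + 1)] with u hu
    exact hu i (Nat.lt_succ_self i)

theorem exists_le_nhds (W : Ultrafilter TreeCompactification) :
    ∃ t, (W : Filter TreeCompactification) ≤ 𝓝 t := by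
  have h : ∀ i, ∃ o, ∀ᶠ t in W, term t i = o := by
    intro i
    obtain ⟨o, ho⟩ : ∃ o, ((W.map fun t => term t i : Ultrafilter (Option Bool)) :
        Filter (Option Bool)) = pure o := by
      obtain ⟨o, ho⟩ := Ultrafilter.eq_pure_of_finite (W.map fun t => term t i)
      exact ⟨o, by rw [ho]; rfl⟩
    refine ⟨o, ?_⟩
    have : {o} ∈ ((W.map fun t => term t i : Ultrafilter (Option Bool)) :
        Filter (Option Bool)) := by rw [ho]; exact mem_pure.2 rfl
    exact this
  choose o ho using h
  have hlt : ∀ n, ∀ᶠ t in W, ∀ i < n, term t i = o i := fun n =>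
    (eventually_all_finite (Set.finite_lt_nat n)).2 fun i _ => ho i
  by_cases hs : ∃ k, o k = none
  -- A sequence without a k-th term is determined by its terms up to k, so `W` is principal.
  · obtain ⟨k, hk⟩ := hs
    obtain ⟨t, ht⟩ := (hlt (k + 1)).exists
    refine ⟨t, le_trans ?_ (pure_le_nhds t)⟩
    rw [le_pure_iff]
    filter_upwards [hlt (k + 1)] with u hu
    have key : ∀ v : TreeCompactification, v.term k = none → ∀ i, k ≤ i → v.term i = none := by
      intro v hv i hi
      cases v with
      | node s => simp only [term, List.getElem?_eq_none_iff] at hv ⊢; omega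
      | branch x => simp [term] at hv
    refine ext_term fun i => ?_
    rcases lt_or_ge i (k + 1) with hi | hi
    · rw [hu i hi, ht i hi]
    · rw [key u ((hu k (by omega)).trans hk) i (by omega),
        key t ((ht k (by omega)).trans hk) i (by omega)]
  · push Not at hs
    choose x hx using fun k => Option.ne_none_iff_exists'.1 (hs k)
    refine ⟨branch x, fun V hV => ?_⟩
    obtain ⟨V', hV', hV'o, hxV'⟩ := mem_nhds_iff.1 hV
    obtain ⟨n, hn⟩ := isOpen_iff.1 hV'o x hxV'
    filter_upwards [hlt n] with t ht
    exact hV' (hn fun i hi => (ht i hi).trans (hx i))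

/-- The first place where `t` fails to agree with the branch `y`. -/
noncomputable def firstDiff (y : ℕ → Bool) (t : TreeCompactification) : ℕ :=
  sInf {n | t.term n ≠ some (y n)}

theorem exists_term_ne {y : ℕ → Bool} {t : TreeCompactification} (h : t ≠ branch y) :
    {n | t.term n ≠ some (y n)}.Nonempty := by
  by_contra hn
  rw [Set.not_nonempty_iff_eq_empty, Set.eq_empty_iff_forall_notMem] at hn
  exact h (ext_term fun i => not_not.1 (hn i))

theorem le_firstDiff {y : ℕ → Bool} {t : TreeCompactification} {n : ℕ} (h : t ≠ branch y)
    (ht : t ∈ wedge y n) : n ≤ firstDiff y t :=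
  le_csInf (exists_term_ne h) fun k hk => not_lt.1 fun hkn => hk (ht k hkn)

/-- The terms up to the first difference decide it, and each is locally constant. At `branch y`
itself the value is the default `sInf ∅ = 0`, although it is unbounded nearby. -/
theorem eventually_firstDiff_eq {y : ℕ → Bool} {t : TreeCompactification} (h : t ≠ branch y) :
    ∀ᶠ u in 𝓝 t, firstDiff y u = firstDiff y t := by
  have hne : t.term (firstDiff y t) ≠ some (y (firstDiff y t)) := Nat.sInf_mem (exists_term_ne h)
  have hlt : ∀ i < firstDiff y t, t.term i = some (y i) := fun i hi =>
    not_not.1 (Nat.notMem_of_lt_sInf hi)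
  have hterm : ∀ᶠ u in 𝓝 t, ∀ i < firstDiff y t + 1, u.term i = t.term i :=
    (eventually_all_finite (Set.finite_lt_nat _)).2 fun i _ =>
      (isLocallyConstant_term i).eventually_eq t
  filter_upwards [hterm] with u hu
  have hu' : u.term (firstDiff y t) ≠ some (y (firstDiff y t)) := by
    rwa [hu _ (Nat.lt_succ_self _)]
  refine le_antisymm (Nat.sInf_le hu') (le_csInf ⟨_, hu'⟩ fun k hk => ?_)
  by_contra! hkt
  exact hk ((hu k (by omega)).trans (hlt k hkt))

theorem tendsto_node_ofFn (x : ℕ → Bool) :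
    Tendsto (fun n => node (List.ofFn fun i : Fin n => x i)) atTop (𝓝 (branch x)) := by
  intro V hV
  obtain ⟨V', hV', hV'o, hxV'⟩ := mem_nhds_iff.1 hV
  obtain ⟨n, hn⟩ := isOpen_iff.1 hV'o x hxV'
  rw [mem_map]
  filter_upwards [eventually_ge_atTop n] with m hm
  refine hV' (hn fun i hi => ?_)
  simp [term, lt_of_lt_of_le hi hm]

end TreeCompactification

/-! ### The space ℂ -/

namespace LindelofCantor

theorem isOpen_iff {V : Set LindelofCantor} : IsOpen V ↔ (infty ∈ V → Vᶜ.Countable) := Iff.rfl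

theorem isOpen_singleton_point (x : ℕ → Bool) : IsOpen {point x} :=
  isOpen_iff.2 fun h => by simp at h

theorem isClosed_singleton (c : LindelofCantor) : IsClosed {c} :=
  isOpen_compl_iff.1 <| isOpen_iff.2 fun _ => by simp

theorem isClopen_singleton_point (x : ℕ → Bool) : IsClopen {point x} :=
  ⟨isClosed_singleton _, isOpen_singleton_point x⟩

theorem countable_compl_of_mem_nhds {V : Set LindelofCantor} (h : V ∈ 𝓝 infty) :
    Vᶜ.Countable := by
  obtain ⟨V', hV', hV'o, hxV'⟩ := mem_nhds_iff.1 h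
  exact (isOpen_iff.1 hV'o hxV').mono (Set.compl_subset_compl.2 hV')

/-- An ultrafilter along which all continuous real functions converge is convergent. -/
theorem exists_le_nhds (W : Ultrafilter LindelofCantor)
    (h : ∀ g : C(LindelofCantor, ℝ), ∃ r, Tendsto g W (𝓝 r)) :
    ∃ c, (W : Filter LindelofCantor) ≤ 𝓝 c := by
  classical
  by_cases hW : (W : Filter LindelofCantor) ≤ 𝓝 infty
  · exact ⟨_, hW⟩
  obtain ⟨V, hV, hVW⟩ := Filter.not_le.1 hW
  -- Numbering the countable complement of `V`, with 0 on `V`, gives a continuous function. Only one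
  -- natural number lies within 1/2 of its limit, so `W` is principal.
  obtain ⟨f, hf⟩ := Set.countable_iff_exists_injOn.1 (countable_compl_of_mem_nhds hV)
  have hg : IsLocallyConstant fun c => if c ∈ V then (0 : ℝ) else f c := by
    refine (IsLocallyConstant.iff_eventually_eq _).2 fun c => ?_
    cases c with
    | point x =>
      filter_upwards [(isOpen_singleton_point x).mem_nhds rfl] with u hu
      rw [Set.mem_singleton_iff.1 hu]
    | infty =>
      filter_upwards [hV] with u hu
      simp [hu, mem_of_mem_nhds hV]
  obtain ⟨r, hr⟩ := h ⟨_, hg.continuous⟩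
  have hS : ∀ᶠ c in W, c ∉ V ∧ |(f c : ℝ) - r| < 1 / 2 := by
    filter_upwards [Ultrafilter.compl_mem_iff_notMem.2 hVW,
      Metric.tendsto_nhds.1 hr (1 / 2) (by norm_num)] with c hc hc'
    have hc : c ∉ V := hc
    refine ⟨hc, ?_⟩
    simpa [hc, Real.dist_eq] using hc'
  obtain ⟨c, hcV, hc⟩ := hS.exists
  refine ⟨c, le_trans ?_ (pure_le_nhds c)⟩
  rw [le_pure_iff]
  filter_upwards [hS] with d hd
  refine hf hd.1 hcV ?_
  have h1 := abs_lt.1 hc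
  have h2 := abs_lt.1 hd.2
  have h3 : (f d : ℝ) < f c + 1 := by linarith
  have h4 : (f c : ℝ) < f d + 1 := by linarith
  norm_cast at h3 h4
  omega

end LindelofCantor

/-! ### Realcompactness of the plank -/

open LindelofCantor TreeCompactification

theorem mk_node_mem_diagonalPlank (c : LindelofCantor) (s : List Bool) :
    (c, node s) ∈ diagonalPlank := Or.inl ⟨c, s, rfl⟩

theorem mk_branch_mem_diagonalPlank_iff {c : LindelofCantor} {y : ℕ → Bool} :
    (c, branch y) ∈ diagonalPlank ↔ c = point y := by
  simp [diagonalPlank]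

theorem continuous_plank_fst : Continuous fun p : diagonalPlank => p.1.1 :=
  continuous_fst.comp continuous_subtype_val

theorem continuous_plank_snd : Continuous fun p : diagonalPlank => p.1.2 :=
  continuous_snd.comp continuous_subtype_val

/-- The first difference from `y`, away from the vertical section at `y`, is locally constant
on the plank. -/
theorem isLocallyConstant_plank_firstDiff (y : ℕ → Bool) :
    IsLocallyConstant fun p : diagonalPlank =>
      open Classical in if p.1.1 = point y then 0 else firstDiff y p.1.2 := by
  refine (IsLocallyConstant.iff_eventually_eq _).2 fun p => ?_
  by_cases hp : p.1.1 = point y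
  · filter_upwards [((isOpen_singleton_point y).preimage continuous_plank_fst).mem_nhds hp]
      with q hq
    have hq : q.1.1 = point y := hq
    simp [hp, hq]
  · have hpb : p.1.2 ≠ branch y := fun h =>
      hp (mk_branch_mem_diagonalPlank_iff.1 (h ▸ p.2 : (p.1.1, branch y) ∈ diagonalPlank))
    filter_upwards [((isClosed_singleton (point y)).isOpen_compl.preimage
        continuous_plank_fst).mem_nhds hp,
      continuous_plank_snd.continuousAt.eventually (eventually_firstDiff_eq hpb)] with q hq hq'
    have hq : q.1.1 ≠ point y := hq
    simp [hp, hq, hq']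

/-- An ultrafilter on the plank along which all continuous real functions converge is
convergent. -/
theorem plank_exists_le_nhds (U : Ultrafilter diagonalPlank)
    (h : ∀ g : C(diagonalPlank, ℝ), ∃ r, Tendsto g U (𝓝 r)) :
    ∃ p, (U : Filter diagonalPlank) ≤ 𝓝 p := by
  classical
  obtain ⟨c, hc⟩ := LindelofCantor.exists_le_nhds (U.map fun p => p.1.1) fun g => by
    obtain ⟨r, hr⟩ := h (g.comp ⟨_, continuous_plank_fst⟩)
    exact ⟨r, tendsto_map'_iff.2 hr⟩
  obtain ⟨t, ht⟩ := TreeCompactification.exists_le_nhds (U.map fun p => p.1.2)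
  have hc : Tendsto (fun p : diagonalPlank => p.1.1) U (𝓝 c) := hc
  have ht : Tendsto (fun p : diagonalPlank => p.1.2) U (𝓝 t) := ht
  by_cases hmem : (c, t) ∈ diagonalPlank
  · refine ⟨⟨(c, t), hmem⟩, ?_⟩
    rw [nhds_induced, ← map_le_iff_le_comap]
    exact hc.prodMk_nhds ht
  exfalso
  cases t with
  | node s => exact hmem (mk_node_mem_diagonalPlank c s)
  | branch y =>
    rw [mk_branch_mem_diagonalPlank_iff] at hmem
    obtain ⟨r, hr⟩ := h ⟨_, ((isLocallyConstant_plank_firstDiff y).comp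
      (fun n : ℕ => (n : ℝ))).continuous⟩
    obtain ⟨m, hm⟩ := exists_nat_ge (r + 1)
    have h1 := hc.eventually_mem ((isClosed_singleton (point y)).isOpen_compl.mem_nhds hmem)
    have h2 := ht.eventually_mem (wedge_mem_nhds y m)
    obtain ⟨p, hp1, hp2, hp3⟩ := (h1.and (h2.and (hr.eventually_lt_const (lt_add_one r)))).exists
    have hp1 : p.1.1 ≠ point y := hp1
    have hpb : p.1.2 ≠ branch y := fun h =>
      hp1 (mk_branch_mem_diagonalPlank_iff.1 (h ▸ p.2 : (p.1.1, branch y) ∈ diagonalPlank))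
    have h3 : m ≤ firstDiff y p.1.2 := le_firstDiff hpb hp2
    have h4 : (firstDiff y p.1.2 : ℝ) < r + 1 := by simpa [hp1] using hp3
    have h5 : (m : ℝ) ≤ firstDiff y p.1.2 := by exact_mod_cast h3
    linarith

theorem plank_eq_of_forall_eq {p q : diagonalPlank} (h : ∀ g : C(diagonalPlank, ℝ), g p = g q) :
    p = q := by
  classical
  -- Indicators of clopen sets detect each isolated value of the first coordinate; ∞ is the only
  -- other value.
  have hclopen : ∀ x : ℕ → Bool, p.1.1 = point x ↔ q.1.1 = point x := by
    intro x
    have hl := ((IsLocallyConstant.iff_continuous _).2 (continuous_boolIndicator_iff_isClopen _ |>.2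
      ((isClopen_singleton_point x).preimage continuous_plank_fst))).comp
      fun b : Bool => if b then (1 : ℝ) else 0
    have := h ⟨_, hl.continuous⟩
    by_cases h1 : p.1.1 = point x <;> by_cases h2 : q.1.1 = point x <;>
      simp [Set.boolIndicator, h1, h2] at this ⊢
  have hterm : ∀ i, p.1.2.term i = q.1.2.term i := by
    intro i
    have hl := ((isLocallyConstant_term i).comp_continuous continuous_plank_snd).comp
      fun o => if o = p.1.2.term i then (1 : ℝ) else 0
    have := h ⟨_, hl.continuous⟩
    by_contra hne
    simp [Ne.symm hne] at this
  refine Subtype.ext (Prod.ext ?_ (ext_term hterm))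
  cases hp : p.1.1 with
  | point x => exact ((hclopen x).1 hp).symm
  | infty =>
    cases hq : q.1.1 with
    | point x => exact hp.symm.trans ((hclopen x).2 hq)
    | infty => rfl

theorem isRealcompact_diagonalPlank : IsRealcompact diagonalPlank := by
  refine ⟨C(diagonalPlank, ℝ), fun p g => g p, ?_⟩
  have hcont : Continuous fun (p : diagonalPlank) (g : C(diagonalPlank, ℝ)) => g p :=
    continuous_pi fun g => g.continuous
  have hproper : IsProperMap fun (p : diagonalPlank) (g : C(diagonalPlank, ℝ)) => g p := by
    refine isProperMap_iff_ultrafilter.2 ⟨hcont, fun U y hU => ?_⟩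
    obtain ⟨p, hp⟩ := plank_exists_le_nhds U fun g => ⟨y g, tendsto_pi_nhds.1 hU g⟩
    exact ⟨p, tendsto_nhds_unique ((hcont.tendsto p).mono_left hp) hU, hp⟩
  exact .of_continuous_injective_isClosedMap hcont
    (fun p q hpq => plank_eq_of_forall_eq fun g => congrFun hpq g) hproper.isClosedMap

/-! ### The right-hand side as a closed copy of ℕ -/

theorem mem_rightHandSide_iff {p : diagonalPlank} : p ∈ rightHandSide ↔ p.1.1 = infty := by
  refine ⟨fun ⟨s, hs⟩ => by rw [hs], fun h => ?_⟩
  obtain ⟨⟨c, t⟩, hp⟩ := p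
  cases t with
  | node s => exact ⟨s, by simpa using h⟩
  | branch y =>
    have h' : c = infty := h
    simp [mk_branch_mem_diagonalPlank_iff.1 hp] at h'

theorem isClosed_rightHandSide : IsClosed rightHandSide := by
  have : rightHandSide = (fun p : diagonalPlank => p.1.1) ⁻¹' {infty} :=
    Set.ext fun _ => mem_rightHandSide_iff
  rw [this]
  exact (isClosed_singleton _).preimage continuous_plank_fst

/-- The point of the right-hand side over a node of the tree. -/
def rightNode (s : List Bool) : rightHandSide :=
  ⟨⟨(infty, node s), mk_node_mem_diagonalPlank _ _⟩, s, rfl⟩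

theorem rightNode_bijective : Function.Bijective rightNode := by
  refine ⟨fun s s' h => ?_, fun ⟨⟨p, hp⟩, s, hs⟩ => ⟨s, Subtype.ext (Subtype.ext hs.symm)⟩⟩
  have := congrArg (fun r : rightHandSide => r.1.1.2) h
  simpa [rightNode] using this

instance discreteTopology_rightHandSide : DiscreteTopology rightHandSide := by
  refine discreteTopology_iff_isOpen_singleton.2 fun r => ?_
  obtain ⟨s, rfl⟩ := rightNode_bijective.2 r
  have : {rightNode s} = (fun r : rightHandSide => r.1.1.2) ⁻¹' {node s} := by
    ext r
    obtain ⟨s', rfl⟩ := rightNode_bijective.2 r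
    rw [Set.mem_singleton_iff, rightNode_bijective.1.eq_iff]
    simp [rightNode]
  rw [this]
  exact (isOpen_singleton_node s).preimage (continuous_plank_snd.comp continuous_subtype_val)

theorem isClosedCopyOfNat_rightHandSide : IsClosedCopyOfNat rightHandSide := by
  refine ⟨isClosed_rightHandSide, ?_⟩
  obtain ⟨e⟩ : Nonempty (List Bool ≃ ℕ) := nonempty_equiv_of_countable
  exact ⟨((Equiv.ofBijective _ rightNode_bijective).symm.trans e).toHomeomorphOfDiscrete⟩

/-! ### Failure of extension -/

/-- A continuous function on the plank agrees, along some branch, with its values on the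
right-hand side. -/
theorem exists_forall_eq_rightNode (g : C(diagonalPlank, ℝ)) :
    ∃ x : ℕ → Bool, ∀ s, g ⟨(point x, node s), mk_node_mem_diagonalPlank _ _⟩ =
      g (rightNode s) := by
  have hs : ∀ s, {c : LindelofCantor | g ⟨(c, node s), mk_node_mem_diagonalPlank _ _⟩ ≠
      g (rightNode s)}.Countable := by
    intro s
    have hc : Continuous fun c : LindelofCantor =>
        g ⟨(c, node s), mk_node_mem_diagonalPlank _ _⟩ := by fun_prop
    have hn : ∀ n : ℕ, {c : LindelofCantor | ¬ dist (g ⟨(c, node s),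
        mk_node_mem_diagonalPlank _ _⟩) (g (rightNode s)) < 1 / ((n : ℝ) + 1)}.Countable :=
      fun n => countable_compl_of_mem_nhds
        (Metric.tendsto_nhds.1 (hc.tendsto infty) _ Nat.one_div_pos_of_nat)
    refine (Set.countable_iUnion hn).mono fun c hcs => ?_
    obtain ⟨n, hn⟩ := exists_nat_one_div_lt (dist_pos.2 hcs)
    exact Set.mem_iUnion.2 ⟨n, not_lt.2 hn.le⟩
  have hU := (Set.countable_iUnion hs).preimage
    (f := point) fun x y h => by simpa using h
  have hne : (⋃ s, {c : LindelofCantor | g ⟨(c, node s), mk_node_mem_diagonalPlank _ _⟩ ≠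
      g (rightNode s)}).preimage point ≠ Set.univ := by
    intro h
    rw [h, Set.countable_univ_iff, ← Cardinal.mk_le_aleph0_iff] at hU
    refine absurd hU (not_le.2 ?_)
    simpa using Cardinal.cantor Cardinal.aleph0
  obtain ⟨x, hx⟩ := (Set.ne_univ_iff_exists_notMem _).1 hne
  refine ⟨x, fun s => ?_⟩
  by_contra hxs
  exact hx (Set.mem_iUnion.2 ⟨s, hxs⟩)

theorem exists_tendsto_rightNode (g : C(diagonalPlank, ℝ)) :
    ∃ (x : ℕ → Bool) (r : ℝ),
      Tendsto (fun n => g (rightNode (List.ofFn fun i : Fin n => x i))) atTop (𝓝 r) := by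
  obtain ⟨x, hx⟩ := exists_forall_eq_rightNode g
  refine ⟨x, g ⟨(point x, branch x), mk_branch_mem_diagonalPlank_iff.2 rfl⟩, ?_⟩
  simp only [← hx]
  exact (g.continuous.tendsto _).comp (tendsto_subtype_rng.2
    (tendsto_const_nhds.prodMk_nhds (tendsto_node_ofFn x)))

theorem not_isCStarEmbedded_rightHandSide : ¬ IsCStarEmbedded rightHandSide := by
  intro h
  -- The parity of the length alternates along every branch.
  obtain ⟨g, hg⟩ := h (BoundedContinuousFunction.ofNormedAddCommGroup
    (fun r => (-1 : ℝ) ^ ((Equiv.ofBijective _ rightNode_bijective).symm r).length)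
    continuous_of_discreteTopology 1 fun r => by simp)
  obtain ⟨x, r, hr⟩ := exists_tendsto_rightNode g.toContinuousMap
  have heq : ∀ n, g (rightNode (List.ofFn fun i : Fin n => x i)) = (-1) ^ n := by
    intro n
    have h1 : (Equiv.ofBijective _ rightNode_bijective).symm
        (rightNode (List.ofFn fun i : Fin n => x i)) = List.ofFn fun i : Fin n => x i :=
      Equiv.ofBijective_symm_apply_apply _ rightNode_bijective _
    rw [hg]
    simp [h1]
  have hr : Tendsto (fun n : ℕ => (-1 : ℝ) ^ n) atTop (𝓝 r) := hr.congr heq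
  -- Shifting by one negates the sequence, so `r = -r`, while its absolute value is constantly 1.
  have h2 := tendsto_nhds_unique ((tendsto_add_atTop_iff_nat 1).2 hr)
    ((hr.neg).congr fun n => by rw [pow_succ]; ring)
  obtain rfl : r = 0 := by linarith
  have h3 : Tendsto (fun _ : ℕ => (1 : ℝ)) atTop (𝓝 0) := by simpa using hr.abs
  exact one_ne_zero (tendsto_nhds_unique tendsto_const_nhds h3)

theorem mainTheorem6 :
    IsRealcompact diagonalPlank ∧
      IsClosedCopyOfNat rightHandSide ∧
      ¬ IsCStarEmbedded rightHandSide :=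
  ⟨isRealcompact_diagonalPlank, isClosedCopyOfNat_rightHandSide,
    not_isCStarEmbedded_rightHandSide⟩
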